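/- Consider a finite collection of bounded plane curves of constant curvature (line segments of positive length, circular arcs, and possibly full circles, a full circle having no endpoints). The \emph{bubbles} of the collection are the connected components of the complement in the plane of the union of the curves, including the unbounded one. The collection is a \emph{planar soap bubble cluster} if (1) the curves are disjoint except for common endpoints, and at each endpoint of a curve exactly three curves meet, forming angles of $2\pi/3$ with each other (Plateau's laws); and (2) for some constant $\sigma>0$ and some assignment of a real pressure to each bubble, the following holds for every curve: orient the curve, and let $\kappa$ be its signed curvature (positive where it turns counterclockwise, zero for a segment); if $B$ is a bubble on its left side and $B'$ a bubble on its right side, then the pressure of $B$ minus the pressure of $B'$ equals $\sigma\kappa$ (the Young--Laplace equation). The \emph{graph} of the cluster is the multigraph whose vertices are the endpoints of the curves and whose edges are the segments and arcs (full circles excluded), each joining its two endpoints. \textbf{Lemma.} In a planar soap bubble cluster, no curve has the same bubble on both of its sides. Moreover, the graph of the cluster is bridgeless: for each edge, its two endpoints remain connected to each other after the edge is deleted. -/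

import Mathlib

open Set Filter Topology

noncomputable section

namespace SoapBubble

/-- A bounded oriented plane curve of constant curvature, parametrized by arc length: it starts at
`start` with unit tangent vector `direction`, has length `length`, and turns counterclockwise at the
constant rate `curvature` (so clockwise if `curvature < 0`). If `curvature = 0` it is a line
segment, otherwise an arc of a circle of radius `1 / |curvature|`. It turns through an angle of at
most `2 * π`, that is, it does not overlap itself; if it turns through exactly `2 * π`, it is a
full circle. -/
structure FilmCurve where
  start : ℂ
  direction : ℂ
  curvature : ℝ
  length : ℝ
  norm_direction : ‖direction‖ = 1
  length_pos : 0 < length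
  turning_le : |curvature| * length ≤ 2 * Real.pi

namespace FilmCurve

variable (γ : FilmCurve)

/-- The unit tangent vector at arc length `s`. -/
def tangent (s : ℝ) : ℂ :=
  γ.direction * Complex.exp (γ.curvature * s * Complex.I)

/-- The point of the curve at arc length `s`. -/
def point (s : ℝ) : ℂ :=
  γ.start + ∫ t in (0 : ℝ)..s, γ.tangent t

/-- With zero curvature the curve is straight. -/
theorem point_of_curvature_eq_zero (h : γ.curvature = 0) (s : ℝ) :
    γ.point s = γ.start + s * γ.direction := by
  simp [point, tangent, h]

/-- With nonzero curvature `κ` the curve lies on the circle of radius `1 / |κ|` whose center is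
at signed distance `1 / κ` to the left of the starting point. -/
theorem point_of_curvature_ne_zero (h : γ.curvature ≠ 0) (s : ℝ) :
    γ.point s = (γ.start + Complex.I * γ.direction / γ.curvature)
      - Complex.I * γ.tangent s / γ.curvature := by
  have hk : (γ.curvature : ℂ) ≠ 0 := by exact_mod_cast h
  have hc : (γ.curvature : ℂ) * Complex.I ≠ 0 := mul_ne_zero hk Complex.I_ne_zero
  have h1 := integral_exp_mul_complex (a := 0) (b := s) hc
  have h2 : ∀ t : ℝ, γ.tangent t =
      γ.direction * Complex.exp (γ.curvature * Complex.I * t) := by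
    intro t
    simp only [tangent]
    congr 2
    ring
  simp only [point, h2]
  rw [intervalIntegral.integral_const_mul, h1]
  simp only [Complex.ofReal_zero, mul_zero, Complex.exp_zero]
  field_simp
  linear_combination γ.direction * (Complex.exp (γ.curvature * Complex.I * s) - 1) * Complex.I_sq

/-- The set of points of the curve. -/
def carrier : Set ℂ :=
  γ.point '' Icc 0 γ.length

/-- The curve is a full circle. -/
def IsFullCircle : Prop :=
  |γ.curvature| * γ.length = 2 * Real.pi

/-- The point at which the curve begins (`false`) or finishes (`true`). -/
def endPoint : Bool → ℂ
  | false => γ.point 0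
  | true => γ.point γ.length

/-- The unit vector in which the curve leaves its beginning (`false`) or, traversed backwards, its
finish (`true`). -/
def outgoing : Bool → ℂ
  | false => γ.tangent 0
  | true => -γ.tangent γ.length

/-- The endpoints of the curve; a full circle has none. -/
def endPoints : Set ℂ :=
  {p | ¬ γ.IsFullCircle ∧ ∃ b, γ.endPoint b = p}

/-- The curve without its endpoints. -/
def relInterior : Set ℂ :=
  γ.carrier \ γ.endPoints

/-- The region `B` lies on the left-hand side of the curve: at some point strictly between the
beginning and the finish, all points sufficiently near on the left normal belong to `B`. -/
def HasOnLeft (B : Set ℂ) : Prop :=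
  ∃ s ∈ Ioo 0 γ.length, ∀ᶠ ε : ℝ in 𝓝[>] 0, γ.point s + ε * (Complex.I * γ.tangent s) ∈ B

/-- The region `B` lies on the right-hand side of the curve: at some point strictly between the
beginning and the finish, all points sufficiently near on the right normal belong to `B`. -/
def HasOnRight (B : Set ℂ) : Prop :=
  ∃ s ∈ Ioo 0 γ.length, ∀ᶠ ε : ℝ in 𝓝[>] 0, γ.point s - ε * (Complex.I * γ.tangent s) ∈ B

end FilmCurve

variable {ι : Type*} (c : ι → FilmCurve)

/-- The union of all curves of the collection. -/
def film : Set ℂ :=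
  ⋃ i, (c i).carrier

/-- A bubble is a connected component of the complement of the film. The unbounded component
(the outside region) counts as a bubble. -/
def IsBubble (B : Set ℂ) : Prop :=
  ∃ z ∈ (film c)ᶜ, B = connectedComponentIn (film c)ᶜ z

/-- The junctions of the collection: all endpoints of its curves. -/
def junctions : Set ℂ :=
  ⋃ i, (c i).endPoints

/-- The curve ends at the point `p`: pairs of a curve that is not a full circle and one of its two
ends, located at `p`. -/
def endsAt (p : ℂ) : Set (ι × Bool) :=
  {e | ¬ (c e.1).IsFullCircle ∧ (c e.1).endPoint e.2 = p}

/-- The planar form of Plateau's laws: the curves (which have constant curvature) are disjoint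
except for common endpoints, and at each endpoint exactly three curves meet, forming angles of
`2 * π / 3` with each other. -/
structure PlateauLaws : Prop where
  disjoint : ∀ i j, i ≠ j → Disjoint (c i).relInterior (c j).carrier
  three_meet : ∀ p ∈ junctions c, (endsAt c p).ncard = 3
  angle_eq : ∀ p ∈ junctions c, ∀ e ∈ endsAt c p, ∀ f ∈ endsAt c p, e ≠ f →
    InnerProductGeometry.angle ((c e.1).outgoing e.2) ((c f.1).outgoing f.2) = 2 * Real.pi / 3

/-- The planar Young–Laplace equation, for some assignment of pressures to the bubbles: the
pressure difference across each curve is a positive constant `σ` times its curvature, the pressure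
being higher on the side towards which the curve bends. -/
def YoungLaplace : Prop :=
  ∃ σ : ℝ, 0 < σ ∧ ∃ pressure : Set ℂ → ℝ, ∀ i B B',
    IsBubble c B → IsBubble c B' → (c i).HasOnLeft B → (c i).HasOnRight B' →
      pressure B - pressure B' = σ * (c i).curvature

/-- A (finite) collection of curves of constant curvature is a planar soap bubble cluster if it
obeys the planar form of Plateau's laws and the Young–Laplace equation. -/
structure IsPlanarCluster [Finite ι] : Prop where
  plateau : PlateauLaws c
  youngLaplace : YoungLaplace c

/-- The multigraph of the collection: its vertices are the junctions, and its edges are the curves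
that are not full circles, each linking its two endpoints. -/
def clusterGraph : Graph ℂ ι where
  vertexSet := junctions c
  IsLink i x y := ¬ (c i).IsFullCircle ∧ ∃ b, (c i).endPoint b = x ∧ (c i).endPoint (!b) = y
  isLink_symm := by
    refine fun i _ => ⟨?_⟩
    rintro x y ⟨hi, b, hx, hy⟩
    exact ⟨hi, !b, hy, by simpa using hx⟩
  eq_or_eq_of_isLink_of_isLink := by
    rintro i x y v w ⟨-, b, rfl, rfl⟩ ⟨-, d, rfl, rfl⟩
    cases b <;> cases d <;> simp
  left_mem_of_isLink := by
    rintro i x y ⟨hi, b, hx, -⟩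
    exact mem_iUnion.2 ⟨i, hi, b, hx⟩

/-- An edge of a multigraph is a bridge if its deletion disconnects its two ends from each
other. -/
def IsBridge {α β : Type*} (G : Graph α β) (e : β) : Prop :=
  ∃ x y, G.IsLink e x y ∧ ¬ Relation.ReflTransGen (G.deleteEdges {e}).Adj x y

/-- A multigraph is bridgeless if none of its edges is a bridge. -/
def Bridgeless {α β : Type*} (G : Graph α β) : Prop :=
  ∀ e, ¬ IsBridge G e

end SoapBubble

end

open Set Filter Topology

noncomputable section

namespace SoapBubble

/-! ### Geometry of a single curve of constant curvature -/

namespace FilmCurve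

variable (γ : FilmCurve)

/-! Bridgelessness is a conservation law. Around a junction the three sectors lie in bubbles, so by
Young–Laplace the three curvatures, read outwards, telescope to `σ * (κ₁ + κ₂ + κ₃) = 0`; the three
outgoing unit tangents also sum to zero, by the angle condition. Along a curve of curvature `κ` the
quantity `T - iκz` (`T` the tangent, `z` the position) is constant. Hence both `κ` and `T - iκz` are
flows on the graph, balanced along every edge and at every vertex (`sum_at_junction`), and no flow
crosses a bridge (`eq_zero_of_isBridge`). On a bridge `κ = 0`, and then `T = 0`, which is absurd for
a unit vector.

A curve with the same bubble on both sides has `κ = 0` by Young–Laplace, so it is a segment. If it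
were not a bridge, the rest of the graph would join its endpoints, closing it to a loop whose
winding number jumps by one across the segment but is constant on the bubble. In
`isBridge_of_both_sides` this is expressed by continuous logarithms: their sum jumps by `2πi` across
the segment. So the segment is a bridge, contradicting the first part. -/

@[fun_prop]
theorem continuous_tangent : Continuous γ.tangent := by
  unfold tangent
  fun_prop

theorem hasDerivAt_point (s : ℝ) : HasDerivAt γ.point (γ.tangent s) s :=
  (intervalIntegral.integral_hasDerivAt_right (γ.continuous_tangent.intervalIntegrable _ _)
    (γ.continuous_tangent.stronglyMeasurableAtFilter _ _)
    γ.continuous_tangent.continuousAt).const_add _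

@[fun_prop]
theorem continuous_point : Continuous γ.point :=
  continuous_iff_continuousAt.2 fun s => (γ.hasDerivAt_point s).continuousAt

@[simp]
theorem point_zero : γ.point 0 = γ.start := by
  simp [point]

@[simp]
theorem tangent_zero : γ.tangent 0 = γ.direction := by
  simp [tangent]

@[simp]
theorem norm_tangent (s : ℝ) : ‖γ.tangent s‖ = 1 := by
  rw [tangent, norm_mul, γ.norm_direction, one_mul, ← Complex.ofReal_mul,
    Complex.norm_exp_ofReal_mul_I]

theorem isCompact_carrier : IsCompact γ.carrier :=
  isCompact_Icc.image γ.continuous_point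

theorem point_mem_carrier {s : ℝ} (hs : s ∈ Icc 0 γ.length) : γ.point s ∈ γ.carrier :=
  mem_image_of_mem _ hs

theorem endPoint_mem_carrier (b : Bool) : γ.endPoint b ∈ γ.carrier := by
  cases b
  · exact γ.point_mem_carrier ⟨le_rfl, γ.length_pos.le⟩
  · exact γ.point_mem_carrier ⟨γ.length_pos.le, le_rfl⟩

/-- The tangent vector turns by the curvature times the displacement, rotated by a right angle. -/
theorem tangent_sub_direction (s : ℝ) :
    γ.tangent s - γ.direction = Complex.I * γ.curvature * (γ.point s - γ.start) := by
  by_cases h : γ.curvature = 0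
  · simp [tangent, h]
  · have hk : (γ.curvature : ℂ) ≠ 0 := by exact_mod_cast h
    rw [γ.point_of_curvature_ne_zero h]
    field_simp
    linear_combination (γ.tangent s - γ.direction) * Complex.I_sq

theorem tangent_re (s : ℝ) :
    (γ.tangent s).re = γ.direction.re - γ.curvature * (γ.point s - γ.start).im := by
  have := congrArg Complex.re (γ.tangent_sub_direction s)
  simp at this ⊢
  linarith

theorem tangent_im (s : ℝ) :
    (γ.tangent s).im = γ.direction.im + γ.curvature * (γ.point s - γ.start).re := by
  have := congrArg Complex.im (γ.tangent_sub_direction s)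
  simp at this ⊢
  linarith

/-- By `tangent_sub_direction`, a return to the start makes the tangent return as well, so the
turning is a multiple of `2π`. Short of a full circle this multiple is zero, and a segment does not
return. -/
theorem point_ne_start (h : ¬ γ.IsFullCircle) {s : ℝ} (hs : s ∈ Ioc 0 γ.length) :
    γ.point s ≠ γ.start := by
  intro hp
  have ht : γ.tangent s = γ.direction := by
    simpa [hp, sub_eq_zero] using γ.tangent_sub_direction s
  have hd : γ.direction ≠ 0 := norm_ne_zero_iff.1 (by simp [γ.norm_direction])
  rw [tangent, mul_eq_left₀ hd, Complex.exp_eq_one_iff] at ht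
  obtain ⟨n, hn⟩ := ht
  have hn' : γ.curvature * s = n * (2 * Real.pi) := by
    have := congrArg Complex.im hn
    simpa using this
  have hlt : |γ.curvature| * γ.length < 2 * Real.pi := lt_of_le_of_ne γ.turning_le h
  have hle : |γ.curvature * s| ≤ |γ.curvature| * γ.length := by
    rw [abs_mul, abs_of_pos hs.1]
    exact mul_le_mul_of_nonneg_left hs.2 (abs_nonneg _)
  have hn0 : n = 0 := by
    rw [hn', abs_mul, abs_of_pos Real.two_pi_pos] at hle
    have h1 : |(n : ℝ)| < 1 := by
      by_contra! h1
      nlinarith [Real.two_pi_pos]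
    exact Int.abs_lt_one_iff.1 (by exact_mod_cast h1)
  have hk : γ.curvature = 0 := by
    have : γ.curvature * s = 0 := by simpa [hn0] using hn'
    exact (mul_eq_zero.1 this).resolve_right hs.1.ne'
  rw [γ.point_of_curvature_eq_zero hk, add_eq_left] at hp
  simp [hd, hs.1.ne'] at hp

/-- The same curve, traversed backwards. -/
def reverse : FilmCurve where
  start := γ.point γ.length
  direction := -γ.tangent γ.length
  curvature := -γ.curvature
  length := γ.length
  norm_direction := by simp
  length_pos := γ.length_pos
  turning_le := by simpa using γ.turning_le

theorem reverse_tangent (s : ℝ) : γ.reverse.tangent s = -γ.tangent (γ.length - s) := by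
  simp only [tangent, reverse, neg_mul, mul_assoc, ← Complex.exp_add]
  congr 3
  push_cast
  ring

theorem reverse_point (s : ℝ) : γ.reverse.point s = γ.point (γ.length - s) := by
  have h : ∀ s : ℝ, HasDerivAt (fun s => γ.reverse.point s - γ.point (γ.length - s)) 0 s := by
    intro s
    have h1 := γ.reverse.hasDerivAt_point s
    have h2 := (γ.hasDerivAt_point (γ.length - s)).scomp s ((hasDerivAt_id s).const_sub γ.length)
    simpa [reverse_tangent, Function.comp_def] using h1.fun_sub h2
  have h0 := is_const_of_deriv_eq_zero (fun s => (h s).differentiableAt) (fun s => (h s).deriv) s 0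
  have h1 : γ.reverse.start = γ.point γ.length := rfl
  simpa [h1, sub_eq_zero] using h0

theorem reverse_carrier : γ.reverse.carrier = γ.carrier := by
  ext z
  constructor
  · rintro ⟨s, hs, rfl⟩
    exact ⟨γ.length - s, ⟨by linarith [hs.2, show γ.reverse.length = γ.length from rfl],
      by linarith [hs.1]⟩, (γ.reverse_point s).symm⟩
  · rintro ⟨s, hs, rfl⟩
    exact ⟨γ.length - s, ⟨by linarith [hs.2],
      by linarith [hs.1, show γ.reverse.length = γ.length from rfl]⟩, by simp [reverse_point]⟩

theorem HasOnLeft.of_reverse {B : Set ℂ} (h : γ.reverse.HasOnLeft B) : γ.HasOnRight B := by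
  obtain ⟨s, hs, h⟩ := h
  refine ⟨γ.length - s, ⟨sub_pos.2 hs.2, by linarith [hs.1]⟩, ?_⟩
  simpa [reverse_point, reverse_tangent, ← sub_eq_add_neg] using h

theorem HasOnRight.of_reverse {B : Set ℂ} (h : γ.reverse.HasOnRight B) : γ.HasOnLeft B := by
  obtain ⟨s, hs, h⟩ := h
  refine ⟨γ.length - s, ⟨sub_pos.2 hs.2, by linarith [hs.1]⟩, ?_⟩
  simpa [reverse_point, reverse_tangent] using h

/-- The curve, oriented so that it leaves its given end. -/
def leaving : Bool → FilmCurve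
  | false => γ
  | true => γ.reverse

@[simp]
theorem leaving_start (b : Bool) : (γ.leaving b).start = γ.endPoint b := by
  cases b
  · exact γ.point_zero.symm
  · rfl

@[simp]
theorem leaving_direction (b : Bool) : (γ.leaving b).direction = γ.outgoing b := by
  cases b
  · exact γ.tangent_zero.symm
  · rfl

@[simp]
theorem leaving_carrier (b : Bool) : (γ.leaving b).carrier = γ.carrier := by
  cases b
  · rfl
  · exact γ.reverse_carrier

theorem leaving_isFullCircle (b : Bool) : (γ.leaving b).IsFullCircle ↔ γ.IsFullCircle := by
  cases b
  · rfl
  · simp [IsFullCircle, leaving, reverse]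

@[simp]
theorem norm_outgoing (b : Bool) : ‖γ.outgoing b‖ = 1 := by
  rw [← leaving_direction, norm_direction]

theorem leaving_curvature_add :
    (γ.leaving false).curvature + (γ.leaving true).curvature = 0 :=
  add_neg_cancel γ.curvature

/-- `T - iκz` is constant along the curve, and reversing the orientation changes its sign. -/
theorem outgoing_sub_add :
    (γ.outgoing false - Complex.I * (γ.leaving false).curvature * γ.endPoint false)
      + (γ.outgoing true - Complex.I * (γ.leaving true).curvature * γ.endPoint true) = 0 := by
  have := γ.tangent_sub_direction γ.length
  simp only [outgoing, leaving, endPoint, reverse, point_zero, tangent_zero]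
  push_cast
  linear_combination -this

/-- A point near the curve on its left normal (on its right normal if `ε < 0`) is on the
corresponding side of the circle or line carrying the curve. -/
theorem inner_normal (s ε : ℝ) :
    inner ℝ (Complex.I * γ.direction)
        (γ.point s + ε * (Complex.I * γ.tangent s) - γ.start)
      - γ.curvature / 2 * ‖γ.point s + ε * (Complex.I * γ.tangent s) - γ.start‖ ^ 2
      = ε - γ.curvature / 2 * ε ^ 2 := by
  have hre := γ.tangent_re s
  have him := γ.tangent_im s
  have hT : (γ.tangent s).re ^ 2 + (γ.tangent s).im ^ 2 = 1 := by
    have := Complex.sq_norm (γ.tangent s)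
    rw [norm_tangent, Complex.normSq_apply] at this
    linarith
  have hd : γ.direction.re ^ 2 + γ.direction.im ^ 2 = 1 := by
    have := Complex.sq_norm γ.direction
    rw [norm_direction, Complex.normSq_apply] at this
    linarith
  have h0 : (γ.direction.re * (γ.point s - γ.start).im - γ.direction.im * (γ.point s - γ.start).re)
      - γ.curvature / 2 * ((γ.point s - γ.start).re ^ 2 + (γ.point s - γ.start).im ^ 2) = 0 := by
    by_cases hk : γ.curvature = 0
    · simp [γ.point_of_curvature_eq_zero hk, hk]
      ring
    -- After multiplication by the curvature, the equation of the circle says that the tangent and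
    -- the initial direction have equal norms.
    · apply mul_left_cancel₀ hk
      rw [hre, him] at hT
      linear_combination (hd - hT) / 2
  rw [Complex.sq_norm, Complex.normSq_apply, Complex.inner]
  rw [show γ.point s + ε * (Complex.I * γ.tangent s) - γ.start
    = (γ.point s - γ.start) + ε * (Complex.I * γ.tangent s) by ring]
  generalize γ.point s - γ.start = u at *
  simp only [Complex.mul_re, Complex.mul_im, Complex.add_re, Complex.add_im, Complex.ofReal_re,
    Complex.ofReal_im, Complex.I_re, Complex.I_im, Complex.conj_re, Complex.conj_im, map_mul,
    Complex.conj_I, Complex.neg_re, Complex.neg_im]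
  rw [hre, him] at hT ⊢
  linear_combination h0 + ε * hT - γ.curvature / 2 * ε ^ 2 * hT

theorem inner_eq_of_mem_carrier {z : ℂ} (hz : z ∈ γ.carrier) :
    inner ℝ (Complex.I * γ.direction) (z - γ.start) = γ.curvature / 2 * ‖z - γ.start‖ ^ 2 := by
  obtain ⟨s, -, rfl⟩ := hz
  simpa [sub_eq_zero] using γ.inner_normal s 0

/-- A curve starting at `γ.start` soon enters every disk that its initial direction points into. -/
theorem eventually_lt_inner {a : ℂ} (ha : 0 < inner ℝ a γ.direction) (R : ℝ) :
    ∀ᶠ s in 𝓝[>] (0 : ℝ), R * ‖γ.point s - γ.start‖ ^ 2 < inner ℝ a (γ.point s - γ.start) := by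
  have hp : HasDerivAt (fun s => γ.point s - γ.start) γ.direction 0 := by
    simpa using (γ.hasDerivAt_point 0).sub_const γ.start
  -- The quadratic term is stationary at the start, so the derivative does not depend on `R`.
  have h1 : HasDerivAt (fun s => inner ℝ a (γ.point s - γ.start)
      - R * ‖γ.point s - γ.start‖ ^ 2) (inner ℝ a γ.direction) 0 := by
    have := ((hasDerivAt_const (0 : ℝ) a).inner ℝ hp).fun_sub (hp.norm_sq.const_mul R)
    simpa using this
  have h2 := (hasDerivAt_iff_tendsto_slope.1 h1).eventually (lt_mem_nhds ha)
  have h3 : ∀ᶠ s in 𝓝[>] (0 : ℝ), 0 < slope (fun s => inner ℝ a (γ.point s - γ.start)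
      - R * ‖γ.point s - γ.start‖ ^ 2) 0 s :=
    h2.filter_mono (nhdsWithin_mono (0 : ℝ) fun s (hs : 0 < s) => hs.ne')
  filter_upwards [h3, self_mem_nhdsWithin] with s hs hs0
  rw [slope_def_field] at hs
  have := (div_pos_iff_of_pos_right (by simpa using hs0)).1 hs
  simpa using this

end FilmCurve

/-! ### The sectors around a junction -/

/-- Points of `K` keep a distance `δ` from `p`, so `R ≥ δ⁻¹` suffices. For a unit vector `a`, the
set `R * ‖z - p‖ ^ 2 < inner ℝ a (z - p)` with `R > 0` is a disk of radius `1 / (2 * R)` with `p` on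
its boundary; by Cauchy–Schwarz the bound makes it miss `K`. -/
theorem eventually_norm_le_mul_sq {K : Set ℂ} (hK : IsClosed K) {p : ℂ} (hp : p ∉ K) :
    ∀ᶠ R : ℝ in atTop, ∀ z ∈ K, ‖z - p‖ ≤ R * ‖z - p‖ ^ 2 := by
  obtain ⟨δ, hδ, hb⟩ := Metric.isOpen_iff.1 hK.isOpen_compl p hp
  filter_upwards [eventually_ge_atTop δ⁻¹] with R hR z hz
  have hzδ : δ ≤ ‖z - p‖ := by
    by_contra! h
    exact hb (by simpa [dist_eq_norm] using h) hz
  have : 1 ≤ R * ‖z - p‖ := by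
    calc (1 : ℝ) = δ⁻¹ * δ := (inv_mul_cancel₀ hδ.ne').symm
      _ ≤ R * ‖z - p‖ := mul_le_mul hR hzδ hδ.le (le_trans (by positivity) hR)
  nlinarith [norm_nonneg (z - p)]

/-- A curve stays outside of a small disk that touches it from behind at its starting point. -/
theorem FilmCurve.eventually_inner_neg_le (γ : FilmCurve) (h : ¬ γ.IsFullCircle) :
    ∀ᶠ R : ℝ in atTop, ∀ z ∈ γ.carrier,
      inner ℝ (-γ.direction) (z - γ.start) ≤ R * ‖z - γ.start‖ ^ 2 := by
  have h1 : (0 : ℝ) < inner ℝ γ.direction γ.direction := by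
    rw [real_inner_self_eq_norm_sq, γ.norm_direction]
    norm_num
  -- Before `r` the curve is in the half-plane ahead of its start (the case `R = 0`); from `r` on it
  -- is a compact set missing the start.
  obtain ⟨r, hr, hr'⟩ := mem_nhdsGT_iff_exists_Ioo_subset.1 (γ.eventually_lt_inner h1 0)
  have hK : IsClosed (γ.point '' Icc r γ.length) :=
    (isCompact_Icc.image γ.continuous_point).isClosed
  have hp : γ.start ∉ γ.point '' Icc r γ.length := by
    rintro ⟨s, hs, hs'⟩
    exact γ.point_ne_start h ⟨lt_of_lt_of_le hr hs.1, hs.2⟩ hs'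
  filter_upwards [eventually_norm_le_mul_sq hK hp, eventually_ge_atTop 0] with R hR hR0 z hz
  obtain ⟨s, hs, rfl⟩ := hz
  rcases lt_or_ge s r with hsr | hsr
  · refine le_trans ?_ (by positivity)
    rcases hs.1.eq_or_lt with rfl | hs0
    · simp
    · have := hr' ⟨hs0, hsr⟩
      simp only [mem_ofPred_eq, zero_mul] at this
      rw [inner_neg_left]
      linarith
  · refine le_trans ?_ (hR _ ⟨s, ⟨hsr, hs.2⟩, rfl⟩)
    simpa [γ.norm_direction] using real_inner_le_norm (-γ.direction) (γ.point s - γ.start)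

/-- Inversion turns intersections of disks, complements of disks and half-planes with a common
boundary point into intersections of half-planes. -/
theorem isPreconnected_inner_gt {κ : Type*} (p : ℂ) (a : κ → ℂ) (k : κ → ℝ)
    (hk : ∃ j, 0 ≤ k j) :
    IsPreconnected {z : ℂ | ∀ j, k j * ‖z - p‖ ^ 2 < inner ℝ (a j) (z - p)} := by
  obtain ⟨j₀, hj₀⟩ := hk
  have hconv : Convex ℝ {w : ℂ | ∀ j, k j < inner ℝ (a j) w} := by
    rw [ofPred_forall]
    exact convex_iInter fun j => convex_halfSpace_gt (innerₛₗ ℝ (a j)).isLinear (k j)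
  have hcont : ContinuousOn (fun w : ℂ => p + (‖w‖ ^ 2)⁻¹ • w)
      {w : ℂ | ∀ j, k j < inner ℝ (a j) w} := by
    -- The nonnegative `k j₀` keeps the origin, the pole of the inversion, out of the convex set.
    have : ∀ w ∈ {w : ℂ | ∀ j, k j < inner ℝ (a j) w}, ‖w‖ ^ 2 ≠ 0 := by
      intro w hw h0
      have := hw j₀
      rw [norm_eq_zero.1 (pow_eq_zero_iff two_ne_zero |>.1 h0), inner_zero_right] at this
      linarith
    fun_prop (disch := assumption)
  convert hconv.isPreconnected.image _ hcont using 1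
  ext z
  constructor
  · intro hz
    have hu : 0 < ‖z - p‖ := by
      rw [norm_pos_iff]
      intro h0
      simpa [h0] using hz j₀
    refine ⟨(‖z - p‖ ^ 2)⁻¹ • (z - p), fun j => ?_, ?_⟩
    · rw [inner_smul_right]
      have := hz j
      rw [inv_mul_eq_div, lt_div_iff₀ (by positivity)]
      exact this
    · simp only [norm_smul, norm_inv, norm_pow, norm_norm, smul_smul]
      have : ((‖z - p‖ ^ 2)⁻¹ * ‖z - p‖) ^ 2 = (‖z - p‖ ^ 2)⁻¹ := by field_simp
      rw [this, inv_inv, mul_inv_cancel₀ (by positivity), one_smul]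
      ring
  · rintro ⟨w, hw, rfl⟩ j
    have hw0 : 0 < ‖w‖ := by
      rw [norm_pos_iff]
      rintro rfl
      have := hw j₀
      rw [inner_zero_right] at this
      linarith
    simp only [add_sub_cancel_left, norm_smul, norm_inv, norm_pow, norm_norm, inner_smul_right]
    have : ((‖w‖ ^ 2)⁻¹ * ‖w‖) ^ 2 = (‖w‖ ^ 2)⁻¹ := by field_simp
    rw [this, mul_comm]
    exact mul_lt_mul_of_pos_left (hw j) (by positivity)

/-- A short step `ε` along the left normal stays in the open set `U`, and by `inner_normal` it goes
to the left of the carrying circle or line, because `ε * (1 - κ / 2 * ε) > 0`. -/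
theorem FilmCurve.hasOnLeft_of_isOpen (γ : FilmCurve) {U B : Set ℂ} (hU : IsOpen U)
    (hs : ∀ᶠ s in 𝓝[>] (0 : ℝ), γ.point s ∈ U)
    (hB : ∀ z ∈ U, γ.curvature / 2 * ‖z - γ.start‖ ^ 2
      < inner ℝ (Complex.I * γ.direction) (z - γ.start) → z ∈ B) :
    γ.HasOnLeft B := by
  obtain ⟨s, hsU, hs0⟩ := (hs.and (Ioo_mem_nhdsGT γ.length_pos)).exists
  refine ⟨s, hs0, ?_⟩
  have hc : Tendsto (fun ε : ℝ => γ.point s + ε * (Complex.I * γ.tangent s)) (𝓝[>] 0)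
      (𝓝 (γ.point s)) := by
    have : Continuous fun ε : ℝ => γ.point s + ε * (Complex.I * γ.tangent s) := by fun_prop
    simpa using (this.tendsto 0).mono_left nhdsWithin_le_nhds
  have hpos : ∀ᶠ ε : ℝ in 𝓝[>] 0, 0 < 1 - γ.curvature / 2 * ε := by
    have : Continuous fun ε : ℝ => 1 - γ.curvature / 2 * ε := by fun_prop
    exact (this.tendsto 0).eventually (lt_mem_nhds (by simp)) |>.filter_mono nhdsWithin_le_nhds
  filter_upwards [hc.eventually (hU.mem_nhds hsU), hpos, self_mem_nhdsWithin] with ε h1 h2 h3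
  refine hB _ h1 ?_
  have := γ.inner_normal s ε
  have := mul_pos h3 h2
  linarith

theorem FilmCurve.hasOnRight_of_isOpen (γ : FilmCurve) {U B : Set ℂ} (hU : IsOpen U)
    (hs : ∀ᶠ s in 𝓝[>] (0 : ℝ), γ.point s ∈ U)
    (hB : ∀ z ∈ U, -(γ.curvature / 2) * ‖z - γ.start‖ ^ 2
      < inner ℝ (-(Complex.I * γ.direction)) (z - γ.start) → z ∈ B) :
    γ.HasOnRight B := by
  obtain ⟨s, hsU, hs0⟩ := (hs.and (Ioo_mem_nhdsGT γ.length_pos)).exists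
  refine ⟨s, hs0, ?_⟩
  have hc : Tendsto (fun ε : ℝ => γ.point s - ε * (Complex.I * γ.tangent s)) (𝓝[>] 0)
      (𝓝 (γ.point s)) := by
    have : Continuous fun ε : ℝ => γ.point s - ε * (Complex.I * γ.tangent s) := by fun_prop
    simpa using (this.tendsto 0).mono_left nhdsWithin_le_nhds
  have hpos : ∀ᶠ ε : ℝ in 𝓝[>] 0, 0 < 1 + γ.curvature / 2 * ε := by
    have : Continuous fun ε : ℝ => 1 + γ.curvature / 2 * ε := by fun_prop
    exact (this.tendsto 0).eventually (lt_mem_nhds (by simp)) |>.filter_mono nhdsWithin_le_nhds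
  filter_upwards [hc.eventually (hU.mem_nhds hsU), hpos, self_mem_nhdsWithin] with ε h1 h2 h3
  refine hB _ h1 ?_
  have h4 := γ.inner_normal s (-ε)
  have := mul_pos h3 h2
  simp only [Complex.ofReal_neg, neg_mul, ← sub_eq_add_neg] at h4
  rw [inner_neg_left]
  linarith

variable {ι : Type*} {c : ι → FilmCurve}

/-- The curve of an end, oriented so that it leaves that end. -/
abbrev leavingAt (c : ι → FilmCurve) (e : ι × Bool) : FilmCurve :=
  (c e.1).leaving e.2

theorem leavingAt_start {p : ℂ} {e : ι × Bool} (he : e ∈ endsAt c p) :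
    (leavingAt c e).start = p := by
  rw [FilmCurve.leaving_start, he.2]

theorem mem_junctions_of_mem_endsAt {p : ℂ} {e : ι × Bool} (he : e ∈ endsAt c p) :
    p ∈ junctions c :=
  mem_iUnion.2 ⟨e.1, he.1, e.2, he.2⟩

theorem mem_carrier_of_mem_endsAt {p : ℂ} {e : ι × Bool} (he : e ∈ endsAt c p) :
    p ∈ (c e.1).carrier :=
  he.2 ▸ (c e.1).endPoint_mem_carrier e.2

/-- The only curves through a junction are those that end there. -/
theorem PlateauLaws.exists_mem_endsAt (h : PlateauLaws c) {p : ℂ} (hp : p ∈ junctions c) {j : ι}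
    (hj : p ∈ (c j).carrier) : ∃ b, (j, b) ∈ endsAt c p := by
  obtain ⟨i, hi, b, hb⟩ := mem_iUnion.1 hp
  by_contra! hne
  have hij : j ≠ i := by
    rintro rfl
    exact hne b ⟨hi, hb⟩
  refine disjoint_left.1 (h.disjoint j i hij) ⟨hj, ?_⟩
    (mem_carrier_of_mem_endsAt (e := (i, b)) ⟨hi, hb⟩)
  rintro ⟨hj', b', hb'⟩
  exact hne b' ⟨hj', hb'⟩

/-- Between two consecutive curves at a junction there is a single bubble, which lies to the left
of the first and to the right of the second. -/
theorem PlateauLaws.exists_isBubble_between [Finite ι] (h : PlateauLaws c) {p : ℂ}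
    {e₁ e₂ e₃ : ι × Bool} (hends : endsAt c p = {e₁, e₂, e₃})
    (hinner : inner ℝ ((c e₁.1).outgoing e₁.2) ((c e₂.1).outgoing e₂.2) = -(1 / 2 : ℝ))
    (hsum : (c e₁.1).outgoing e₁.2 + (c e₂.1).outgoing e₂.2 + (c e₃.1).outgoing e₃.2 = 0)
    (hcross : 0 < inner ℝ (Complex.I * (c e₁.1).outgoing e₁.2) ((c e₂.1).outgoing e₂.2)) :
    ∃ B, IsBubble c B ∧ (leavingAt c e₁).HasOnLeft B ∧ (leavingAt c e₂).HasOnRight B := by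
  have he₁ : e₁ ∈ endsAt c p := by simp [hends]
  have he₂ : e₂ ∈ endsAt c p := by simp [hends]
  have he₃ : e₃ ∈ endsAt c p := by simp [hends]
  have hp : p ∈ junctions c := mem_junctions_of_mem_endsAt he₁
  set γ₁ := leavingAt c e₁ with hγ₁
  set γ₂ := leavingAt c e₂ with hγ₂
  set γ₃ := leavingAt c e₃ with hγ₃
  have hs₁ : γ₁.start = p := leavingAt_start he₁
  have hs₂ : γ₂.start = p := leavingAt_start he₂
  have hs₃ : γ₃.start = p := leavingAt_start he₃
  simp only [← FilmCurve.leaving_direction] at hinner hsum hcross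
  change inner ℝ γ₁.direction γ₂.direction = _ at hinner
  change γ₁.direction + γ₂.direction + γ₃.direction = 0 at hsum
  change 0 < inner ℝ (Complex.I * γ₁.direction) γ₂.direction at hcross
  -- The direction opposite to the third curve bisects the sector between the first two.
  have hm : -γ₃.direction = γ₁.direction + γ₂.direction := by linear_combination -hsum
  have hm₁ : 0 < inner ℝ (-γ₃.direction) γ₁.direction := by
    rw [hm, inner_add_left, real_inner_self_eq_norm_sq, γ₁.norm_direction, real_inner_comm, hinner]
    norm_num
  have hm₂ : 0 < inner ℝ (-γ₃.direction) γ₂.direction := by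
    rw [hm, inner_add_left, real_inner_self_eq_norm_sq, γ₂.norm_direction, hinner]
    norm_num
  have hcross' : 0 < inner ℝ (-(Complex.I * γ₂.direction)) γ₁.direction := by
    convert hcross using 1
    simp [Complex.inner]
    ring
  -- No film meets the sector for large `R`: the first two curves lie on its bounding circles or
  -- lines, the third is kept out by a small disk touching it from behind, and the curves that miss
  -- `p` stay away from that disk.
  have hfilm : ∀ᶠ R : ℝ in atTop, ∀ j, ∀ z ∈ (c j).carrier,
      γ₁.curvature / 2 * ‖z - p‖ ^ 2 < inner ℝ (Complex.I * γ₁.direction) (z - p) →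
      -(γ₂.curvature / 2) * ‖z - p‖ ^ 2 < inner ℝ (-(Complex.I * γ₂.direction)) (z - p) →
      inner ℝ (-γ₃.direction) (z - p) ≤ R * ‖z - p‖ ^ 2 := by
    refine eventually_all.2 fun j => ?_
    by_cases hj : p ∈ (c j).carrier
    · obtain ⟨b, hb⟩ := h.exists_mem_endsAt hp hj
      have hb' := hb
      rw [hends] at hb'
      rcases hb' with rfl | rfl | hb'
      · refine Eventually.of_forall fun R z hz h₁ _ => absurd h₁ (not_lt_of_ge ?_)
        rw [← hs₁]
        exact (γ₁.inner_eq_of_mem_carrier (by simpa [hγ₁] using hz)).le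
      · refine Eventually.of_forall fun R z hz _ h₂ => absurd h₂ (not_lt_of_ge ?_)
        rw [← hs₂, inner_neg_left, γ₂.inner_eq_of_mem_carrier (by simpa [hγ₂] using hz), neg_mul]
      · obtain rfl : (j, b) = e₃ := hb'
        have h3 : ¬ γ₃.IsFullCircle := by
          rw [hγ₃, FilmCurve.leaving_isFullCircle]
          exact hb.1
        filter_upwards [γ₃.eventually_inner_neg_le h3] with R hR z hz _ _
        rw [← hs₃]
        exact hR z (by simpa [hγ₃] using hz)
    · filter_upwards [eventually_norm_le_mul_sq (c j).isCompact_carrier.isClosed hj]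
        with R hR z hz _ _
      refine le_trans ?_ (hR z hz)
      simpa [γ₃.norm_direction] using real_inner_le_norm (-γ₃.direction) (z - p)
  obtain ⟨R, hR, hR0⟩ := (hfilm.and (eventually_ge_atTop 0)).exists
  set S : Set ℂ := {z | γ₁.curvature / 2 * ‖z - p‖ ^ 2 < inner ℝ (Complex.I * γ₁.direction) (z - p) ∧
    -(γ₂.curvature / 2) * ‖z - p‖ ^ 2 < inner ℝ (-(Complex.I * γ₂.direction)) (z - p) ∧
    R * ‖z - p‖ ^ 2 < inner ℝ (-γ₃.direction) (z - p)} with hS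
  have hSpre : IsPreconnected S := by
    convert isPreconnected_inner_gt p
      ![Complex.I * γ₁.direction, -(Complex.I * γ₂.direction), -γ₃.direction]
      ![γ₁.curvature / 2, -(γ₂.curvature / 2), R] ⟨2, hR0⟩ using 1
    ext z
    simp [hS, Fin.forall_fin_succ, -Complex.inner]
  have hSfilm : S ⊆ (film c)ᶜ := by
    intro z hz hzf
    obtain ⟨j, hj⟩ := mem_iUnion.1 hzf
    exact absurd (hR j z hj hz.1 hz.2.1) (not_le_of_gt hz.2.2)
  have hopen : ∀ (a : ℂ) (k : ℝ), IsOpen {z : ℂ | k * ‖z - p‖ ^ 2 < inner ℝ a (z - p)} :=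
    fun a k => isOpen_lt (by fun_prop) (by fun_prop)
  have hleft : γ₁.HasOnLeft S := by
    refine γ₁.hasOnLeft_of_isOpen ((hopen _ _).inter (hopen _ _))
      (U := {z | -(γ₂.curvature / 2) * ‖z - p‖ ^ 2 < inner ℝ (-(Complex.I * γ₂.direction)) (z - p)} ∩
        {z | R * ‖z - p‖ ^ 2 < inner ℝ (-γ₃.direction) (z - p)}) ?_ ?_
    · filter_upwards [γ₁.eventually_lt_inner hcross' (-(γ₂.curvature / 2)),
        γ₁.eventually_lt_inner hm₁ R] with s h1 h2
      rw [hs₁] at h1 h2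
      exact ⟨h1, h2⟩
    · rw [hs₁]
      exact fun z hz hz' => ⟨hz', hz⟩
  have hright : γ₂.HasOnRight S := by
    refine γ₂.hasOnRight_of_isOpen ((hopen _ _).inter (hopen _ _))
      (U := {z | γ₁.curvature / 2 * ‖z - p‖ ^ 2 < inner ℝ (Complex.I * γ₁.direction) (z - p)} ∩
        {z | R * ‖z - p‖ ^ 2 < inner ℝ (-γ₃.direction) (z - p)}) ?_ ?_
    · filter_upwards [γ₂.eventually_lt_inner hcross (γ₁.curvature / 2),
        γ₂.eventually_lt_inner hm₂ R] with s h1 h2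
      rw [hs₂] at h1 h2
      exact ⟨h1, h2⟩
    · rw [hs₂]
      exact fun z hz hz' => ⟨hz.1, hz', hz.2⟩
  obtain ⟨s, hs, hε⟩ := hleft
  obtain ⟨ε, hz⟩ := hε.exists
  have hsub := hSpre.subset_connectedComponentIn hz hSfilm
  refine ⟨_, ⟨_, hSfilm hz, rfl⟩, ⟨s, hs, hε.mono fun _ h => hsub h⟩, ?_⟩
  obtain ⟨t, ht, hε'⟩ := hright
  exact ⟨t, ht, hε'.mono fun _ h => hsub h⟩

/-! ### Equilibrium at a junction -/

/-- Reversing a curve exchanges its sides and negates its curvature, so Young–Laplace holds for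
either orientation. -/
theorem leavingAt_pressure {σ : ℝ} {pressure : Set ℂ → ℝ}
    (hYL : ∀ i B B', IsBubble c B → IsBubble c B' → (c i).HasOnLeft B → (c i).HasOnRight B' →
      pressure B - pressure B' = σ * (c i).curvature)
    (e : ι × Bool) {B B' : Set ℂ} (hB : IsBubble c B) (hB' : IsBubble c B')
    (hl : (leavingAt c e).HasOnLeft B) (hr : (leavingAt c e).HasOnRight B') :
    pressure B - pressure B' = σ * (leavingAt c e).curvature := by
  obtain ⟨i, _ | _⟩ := e
  · exact hYL i B B' hB hB' hl hr
  · have := hYL i B' B hB' hB (FilmCurve.HasOnRight.of_reverse _ hr)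
      (FilmCurve.HasOnLeft.of_reverse _ hl)
    have hk : (leavingAt c (i, true)).curvature = -(c i).curvature := rfl
    rw [hk]
    linarith

/-- Three unit vectors at angles of `2 * π / 3` with each other are in equilibrium. -/
theorem add_add_eq_zero_of_inner {a b d : ℂ} (ha : ‖a‖ = 1) (hb : ‖b‖ = 1) (hd : ‖d‖ = 1)
    (hab : inner ℝ a b = -(1 / 2 : ℝ)) (had : inner ℝ a d = -(1 / 2 : ℝ))
    (hbd : inner ℝ b d = -(1 / 2 : ℝ)) : a + b + d = 0 := by
  have h1 := norm_add_sq_real (a + b) d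
  have h2 := norm_add_sq_real a b
  rw [inner_add_left, had, hbd, h2, ha, hb, hd, hab] at h1
  have : ‖a + b + d‖ ^ 2 = 0 := by rw [h1]; norm_num
  exact norm_eq_zero.1 (pow_eq_zero_iff two_ne_zero |>.1 this)

theorem PlateauLaws.inner_outgoing (h : PlateauLaws c) {p : ℂ} {e f : ι × Bool}
    (he : e ∈ endsAt c p) (hf : f ∈ endsAt c p) (hef : e ≠ f) :
    inner ℝ ((c e.1).outgoing e.2) ((c f.1).outgoing f.2) = -(1 / 2 : ℝ) := by
  have ha := h.angle_eq p (mem_junctions_of_mem_endsAt he) e he f hf hef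
  rw [← InnerProductGeometry.cos_angle_mul_norm_mul_norm, ha, FilmCurve.norm_outgoing,
    FilmCurve.norm_outgoing, show 2 * Real.pi / 3 = Real.pi - Real.pi / 3 by ring,
    Real.cos_pi_sub, Real.cos_pi_div_three]
  norm_num

/-- The three curves at a junction, in counterclockwise order. -/
theorem PlateauLaws.exists_endsAt_eq (h : PlateauLaws c) {p : ℂ} (hp : p ∈ junctions c) :
    ∃ e₁ e₂ e₃ : ι × Bool, e₁ ≠ e₂ ∧ e₁ ≠ e₃ ∧ e₂ ≠ e₃ ∧ endsAt c p = {e₁, e₂, e₃} ∧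
      0 < inner ℝ (Complex.I * (c e₁.1).outgoing e₁.2) ((c e₂.1).outgoing e₂.2) := by
  obtain ⟨e₁, e₂, e₃, h12, h13, h23, hends⟩ := ncard_eq_three.1 (h.three_meet p hp)
  have hi := h.inner_outgoing (p := p) (by simp [hends]) (by simp [hends]) h12
  have hswap : ∀ a b : ℂ, inner ℝ (Complex.I * b) a = -inner ℝ (Complex.I * a) b := by
    intro a b
    simp [Complex.inner]
    ring
  have hsq : ∀ a b : ℂ, inner ℝ (Complex.I * a) b ^ 2 + inner ℝ a b ^ 2 = ‖a‖ ^ 2 * ‖b‖ ^ 2 := by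
    intro a b
    rw [Complex.sq_norm, Complex.sq_norm, Complex.normSq_apply, Complex.normSq_apply]
    simp [Complex.inner]
    ring
  -- Inner product `-1/2` between unit vectors leaves `3/4` for the square of their cross product;
  -- its sign then decides the cyclic order.
  have hne : inner ℝ (Complex.I * (c e₁.1).outgoing e₁.2) ((c e₂.1).outgoing e₂.2) ≠ 0 := by
    intro h0
    have := hsq ((c e₁.1).outgoing e₁.2) ((c e₂.1).outgoing e₂.2)
    rw [h0, hi, FilmCurve.norm_outgoing, FilmCurve.norm_outgoing] at this
    norm_num at this
  rcases hne.lt_or_gt with hlt | hgt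
  · refine ⟨e₂, e₁, e₃, h12.symm, h23, h13, hends.trans (insert_comm _ _ _), ?_⟩
    rw [hswap]
    linarith
  · exact ⟨e₁, e₂, e₃, h12, h13, h23, hends, hgt⟩

/-- Each sector's bubble is on the left of one curve and on the right of the next, so its pressure
cancels in the sum of the three Young–Laplace equations. The bubbles need not be distinct. -/
theorem IsPlanarCluster.sum_at_junction [Finite ι] (h : IsPlanarCluster c) {p : ℂ}
    (hp : p ∈ junctions c) :
    ∃ e₁ e₂ e₃ : ι × Bool, e₁ ≠ e₂ ∧ e₁ ≠ e₃ ∧ e₂ ≠ e₃ ∧ endsAt c p = {e₁, e₂, e₃} ∧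
      (c e₁.1).outgoing e₁.2 + (c e₂.1).outgoing e₂.2 + (c e₃.1).outgoing e₃.2 = 0 ∧
      (leavingAt c e₁).curvature + (leavingAt c e₂).curvature + (leavingAt c e₃).curvature = 0 := by
  obtain ⟨e₁, e₂, e₃, h12, h13, h23, hends, hcross⟩ := h.plateau.exists_endsAt_eq hp
  have he₁ : e₁ ∈ endsAt c p := by simp [hends]
  have he₂ : e₂ ∈ endsAt c p := by simp [hends]
  have he₃ : e₃ ∈ endsAt c p := by simp [hends]
  have i12 := h.plateau.inner_outgoing he₁ he₂ h12
  have i13 := h.plateau.inner_outgoing he₁ he₃ h13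
  have i23 := h.plateau.inner_outgoing he₂ he₃ h23
  have i31 := h.plateau.inner_outgoing he₃ he₁ h13.symm
  have hsum := add_add_eq_zero_of_inner ((c e₁.1).norm_outgoing e₁.2)
    ((c e₂.1).norm_outgoing e₂.2) ((c e₃.1).norm_outgoing e₃.2) i12 i13 i23
  refine ⟨e₁, e₂, e₃, h12, h13, h23, hends, hsum, ?_⟩
  have hd₃ : (c e₃.1).outgoing e₃.2 = -(c e₁.1).outgoing e₁.2 - (c e₂.1).outgoing e₂.2 := by
    linear_combination hsum
  have hcross23 : 0 < inner ℝ (Complex.I * (c e₂.1).outgoing e₂.2) ((c e₃.1).outgoing e₃.2) := by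
    rw [hd₃]
    convert hcross using 1
    simp [Complex.inner]
    ring
  have hcross31 : 0 < inner ℝ (Complex.I * (c e₃.1).outgoing e₃.2) ((c e₁.1).outgoing e₁.2) := by
    rw [hd₃]
    convert hcross using 1
    simp [Complex.inner]
    ring
  obtain ⟨B₁, hB₁, hl₁, hr₁⟩ := h.plateau.exists_isBubble_between hends i12 hsum hcross
  obtain ⟨B₂, hB₂, hl₂, hr₂⟩ := h.plateau.exists_isBubble_between (e₁ := e₂) (e₂ := e₃) (e₃ := e₁)
    (by rw [hends]; ext; simp; tauto) i23 (by linear_combination hsum) hcross23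
  obtain ⟨B₃, hB₃, hl₃, hr₃⟩ := h.plateau.exists_isBubble_between (e₁ := e₃) (e₂ := e₁) (e₃ := e₂)
    (by rw [hends]; ext; simp; tauto) i31 (by linear_combination hsum) hcross31
  obtain ⟨σ, hσ, pressure, hYL⟩ := h.youngLaplace
  have p₁ := leavingAt_pressure hYL e₁ hB₁ hB₃ hl₁ hr₃
  have p₂ := leavingAt_pressure hYL e₂ hB₂ hB₁ hl₂ hr₁
  have p₃ := leavingAt_pressure hYL e₃ hB₃ hB₂ hl₃ hr₂
  apply mul_left_cancel₀ hσ.ne'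
  linear_combination -p₁ - p₂ - p₃

/-! ### Flows and bridges -/

/-- A quantity that is balanced at every junction and along every curve does not flow through a
bridge. -/
theorem eq_zero_of_isBridge [Finite ι] {M : Type*} [AddCommGroup M] (Q : ι × Bool → M)
    (hcurve : ∀ i, Q (i, false) + Q (i, true) = 0)
    (hjunction : ∀ p ∈ junctions c, ∑ᶠ e ∈ endsAt c p, Q e = 0)
    {i : ι} (hi : IsBridge (clusterGraph c) i) : ∃ b, Q (i, b) = 0 := by
  classical
  have := Fintype.ofFinite ι
  obtain ⟨x, y, ⟨hfull, b, hx, hy⟩, hxy⟩ := hi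
  refine ⟨b, ?_⟩
  set X : Set ℂ := {z | Relation.ReflTransGen ((clusterGraph c).deleteEdges {i}).Adj x z} with hX
  have hxX : x ∈ X := Relation.ReflTransGen.refl
  have hstep : ∀ j, j ≠ i → ¬ (c j).IsFullCircle →
      ∀ d, (c j).endPoint d ∈ X → (c j).endPoint (!d) ∈ X := by
    intro j hj hjf d hd
    refine Relation.ReflTransGen.tail hd ⟨j, ?_⟩
    rw [Graph.deleteEdges_isLink]
    exact ⟨⟨hjf, d, rfl, rfl⟩, hj⟩
  set s : Finset (ι × Bool) := Finset.univ.filter fun e =>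
    ¬ (c e.1).IsFullCircle ∧ (c e.1).endPoint e.2 ∈ X with hs
  have h0 : ∑ e ∈ s, Q e = 0 := by
    -- Grouped by junction, the total over all ends in the component `X` of `x` vanishes.
    rw [← Finset.sum_fiberwise_of_maps_to
      (g := fun e => (c e.1).endPoint e.2) (fun e he => Finset.mem_image_of_mem _ he)]
    refine Finset.sum_eq_zero fun p hp => ?_
    obtain ⟨e, he, rfl⟩ := Finset.mem_image.1 hp
    rw [hs, Finset.mem_filter] at he
    rw [← hjunction _ (mem_junctions_of_mem_endsAt (e := e) ⟨he.2.1, rfl⟩)]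
    rw [finsum_mem_eq_finite_toFinset_sum _ (toFinite _)]
    refine Finset.sum_congr ?_ fun _ _ => rfl
    ext f
    simp only [hs, Finset.mem_filter, Finset.mem_univ, true_and, Finite.mem_toFinset, endsAt,
      mem_ofPred_eq]
    refine ⟨fun h => ⟨h.1.1, h.2⟩, fun h => ⟨⟨h.1, ?_⟩, h.2⟩⟩
    rw [h.2]
    exact he.2.2
  -- Grouped by curve, every curve other than `i` has both ends in `X` or neither and contributes
  -- zero; only one end of `i` survives.
  rw [hs, Finset.sum_filter, Fintype.sum_prod_type, Finset.sum_eq_single i] at h0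
  · have hyX : (c i).endPoint (!b) ∉ X := hy ▸ hxy
    rw [← hx] at hxX
    cases b <;> simp_all
  · intro j _ hj
    have h1 := hstep j hj
    have h2 := hcurve j
    by_cases hjf : (c j).IsFullCircle
    · simp [hjf]
    · have h3 := h1 hjf true
      have h4 := h1 hjf false
      simp only [Bool.not_true, Bool.not_false] at h3 h4
      by_cases h5 : (c j).endPoint true ∈ X
      · simp only [Fintype.sum_bool, hjf, h5, h3 h5, not_false_eq_true, and_self, if_true]
        rwa [add_comm]
      · simp [h5, mt h4 h5]
  · simp

theorem finsum_mem_triple {α M : Type*} [AddCommMonoid M] {a b d : α} (f : α → M) (hab : a ≠ b)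
    (had : a ≠ d) (hbd : b ≠ d) : ∑ᶠ x ∈ ({a, b, d} : Set α), f x = f a + f b + f d := by
  rw [finsum_mem_insert f (by simp [hab, had]) (toFinite _), finsum_mem_pair hbd, add_assoc]

/-- The flow `κ` shows that a bridge is straight. At a junction `p` the flow `T - iκz` sums to `∑ T
- ip ∑ κ = 0`; on a straight bridge it is the unit tangent, which cannot vanish. -/
theorem IsPlanarCluster.bridgeless [Finite ι] (h : IsPlanarCluster c) :
    Bridgeless (clusterGraph c) := by
  intro i hi
  obtain ⟨b, hb⟩ := eq_zero_of_isBridge (fun e => (leavingAt c e).curvature)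
    (fun j => (c j).leaving_curvature_add) (fun p hp => by
      obtain ⟨e₁, e₂, e₃, h12, h13, h23, hends, -, hk⟩ := h.sum_at_junction hp
      rw [hends, finsum_mem_triple _ h12 h13 h23, hk]) hi
  have hk : (c i).curvature = 0 := by
    cases b
    · exact hb
    · exact neg_eq_zero.1 hb
  obtain ⟨b', hb'⟩ := eq_zero_of_isBridge (fun e => (c e.1).outgoing e.2
      - Complex.I * (leavingAt c e).curvature * (c e.1).endPoint e.2)
    (fun j => (c j).outgoing_sub_add) (fun p hp => by
      obtain ⟨e₁, e₂, e₃, h12, h13, h23, hends, hd, hk⟩ := h.sum_at_junction hp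
      rw [hends, finsum_mem_triple _ h12 h13 h23]
      have he₁ : e₁ ∈ endsAt c p := by simp [hends]
      have he₂ : e₂ ∈ endsAt c p := by simp [hends]
      have he₃ : e₃ ∈ endsAt c p := by simp [hends]
      have hk' := congrArg (fun r : ℝ => (r : ℂ)) hk
      push_cast at hk'
      rw [he₁.2, he₂.2, he₃.2]
      linear_combination hd - Complex.I * p * hk') hi
  have hk' : (leavingAt c (i, b')).curvature = 0 := by
    cases b'
    · exact hk
    · exact neg_eq_zero.2 hk
  have hn := (c i).norm_outgoing b'
  simp only [hk', Complex.ofReal_zero, mul_zero, zero_mul, sub_zero] at hb'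
  rw [hb', norm_zero] at hn
  exact zero_ne_one hn

/-! ### Logarithms and the two sides of a segment -/

/-- A continuous branch, off the curve, of the logarithm of the quotient of the differences to its
two endpoints. -/
theorem FilmCurve.exists_continuousOn_exp (γ : FilmCurve) :
    ∃ f : ℂ → ℂ, ContinuousOn f γ.carrierᶜ ∧ ∀ z ∉ γ.carrier,
      (γ.endPoint false - z) * Complex.exp (f z) = γ.endPoint true - z := by
  -- This is the integral of `dw / (w - z)` along the curve up to arc length `u`.
  set F : ℂ → ℝ → ℂ := fun z u => ∫ s in (0 : ℝ)..u, γ.tangent s / (γ.point s - z) with hF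
  refine ⟨fun z => F z γ.length, ?_, fun z hz => ?_⟩
  · rw [continuousOn_iff_continuous_domRestrict]
    have hL := γ.length_pos.le
    -- Clamping `s` to the parameter interval keeps the denominator nonzero for all real `s`.
    have hc : Continuous fun z : ↥γ.carrierᶜ => ∫ s in (0 : ℝ)..γ.length,
        γ.tangent (projIcc 0 γ.length hL s) / (γ.point (projIcc 0 γ.length hL s) - z) := by
      refine intervalIntegral.continuous_parametric_intervalIntegral_of_continuous' ?_ _ _
      refine Continuous.div (by fun_prop) (by fun_prop) fun x => ?_
      rw [sub_ne_zero]
      intro h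
      exact x.1.2 (h ▸ γ.point_mem_carrier (projIcc 0 γ.length hL x.2).2)
    refine hc.congr fun z => ?_
    refine intervalIntegral.integral_congr fun s hs => ?_
    rw [uIcc_of_le hL] at hs
    simp only [projIcc_of_mem hL hs]
  · have hne : ∀ s ∈ Icc 0 γ.length, γ.point s - z ≠ 0 := fun s hs =>
      sub_ne_zero.2 fun h => hz (h ▸ γ.point_mem_carrier hs)
    have hcont : ContinuousOn (fun s => γ.tangent s / (γ.point s - z)) (Icc 0 γ.length) :=
      ContinuousOn.div (by fun_prop) (by fun_prop) hne
    -- Only right derivatives are used, since the integrand is controlled only on the parameter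
    -- interval.
    have hderiv : ∀ u ∈ Ico 0 γ.length, HasDerivWithinAt
        (fun u => (γ.point u - z) * Complex.exp (-F z u)) 0 (Ici u) u := by
      intro u hu
      have hmem : Icc 0 γ.length ∈ 𝓝[>] u :=
        mem_of_superset (Ioo_mem_nhdsGT hu.2) fun s hs => ⟨hu.1.trans hs.1.le, hs.2.le⟩
      have h1 : HasDerivWithinAt (F z) (γ.tangent u / (γ.point u - z)) (Ici u) u := by
        refine intervalIntegral.integral_hasDerivWithinAt_right (t := Ioi u) ?_ ?_ ?_
        · refine (hcont.mono ?_).intervalIntegrable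
          rw [uIcc_of_le hu.1]
          exact Icc_subset_Icc le_rfl hu.2.le
        · exact ⟨_, hmem, hcont.aestronglyMeasurable measurableSet_Icc⟩
        · exact ((hcont u ⟨hu.1, hu.2.le⟩).mono_of_mem_nhdsWithin hmem)
      have h2 := ((γ.hasDerivAt_point u).hasDerivWithinAt (s := Ici u)).sub_const z
      refine (h2.fun_mul h1.fun_neg.cexp).congr_deriv ?_
      linear_combination -Complex.exp (-F z u) *
        mul_div_cancel₀ (γ.tangent u) (hne u ⟨hu.1, hu.2.le⟩)
    have hFc : ContinuousOn (F z) (Icc 0 γ.length) := by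
      have := intervalIntegral.continuousOn_primitive_interval
        (μ := MeasureTheory.volume) (a := 0) (b := γ.length)
        (f := fun s => γ.tangent s / (γ.point s - z)) ?_
      · rwa [uIcc_of_le γ.length_pos.le] at this
      · rw [uIcc_of_le γ.length_pos.le]
        exact hcont.integrableOn_Icc
    have hconst := constant_of_has_deriv_right_zero
      (f := fun u => (γ.point u - z) * Complex.exp (-F z u))
      (by fun_prop) hderiv γ.length ⟨γ.length_pos.le, le_rfl⟩
    have hF0 : F z 0 = 0 := by simp [hF]
    simp only [hF0, neg_zero, Complex.exp_zero, mul_one] at hconst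
    simp only [endPoint]
    rw [← hconst, mul_assoc, ← Complex.exp_add, neg_add_cancel, Complex.exp_zero, mul_one]

/-- The branches for the curves of a walk add up, with a minus sign for a curve traversed backwards,
and the quotients telescope. -/
theorem exists_continuousOn_exp_of_reflTransGen {i : ι} {x y : ℂ}
    (h : Relation.ReflTransGen ((clusterGraph c).deleteEdges {i}).Adj x y) :
    ∃ f : ℂ → ℂ, ContinuousOn f {z | ∀ j, j ≠ i → z ∉ (c j).carrier} ∧
      ∀ z, (∀ j, j ≠ i → z ∉ (c j).carrier) → (x - z) * Complex.exp (f z) = y - z := by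
  induction h with
  | refl => exact ⟨0, continuousOn_const, by simp⟩
  | @tail u v _ huv ih =>
    obtain ⟨f, hf, hfe⟩ := ih
    obtain ⟨j, hj⟩ := huv
    rw [Graph.deleteEdges_isLink] at hj
    obtain ⟨⟨-, b, rfl, rfl⟩, hji⟩ := hj
    obtain ⟨g, hg, hge⟩ := (c j).exists_continuousOn_exp
    have hg' : ContinuousOn g {z | ∀ j, j ≠ i → z ∉ (c j).carrier} :=
      hg.mono fun z hz => hz j hji
    cases b
    · refine ⟨fun z => f z + g z, hf.add hg', fun z hz => ?_⟩
      rw [Complex.exp_add, ← mul_assoc, hfe z hz, hge z (hz j hji)]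
      rfl
    · refine ⟨fun z => f z - g z, hf.sub hg', fun z hz => ?_⟩
      rw [Complex.exp_sub, mul_div_assoc', hfe z hz, ← hge z (hz j hji),
        mul_div_cancel_right₀ _ (Complex.exp_ne_zero _)]
      rfl

/-- Continuous branches of the logarithm of a constant are constant. -/
theorem eq_of_exp_eq {X : Type*} [TopologicalSpace X] {S : Set X} (hS : IsPreconnected S)
    {f : X → ℂ} (hf : ContinuousOn f S) {w : ℂ} (hw : ∀ z ∈ S, Complex.exp (f z) = w) {a b : X}
    (ha : a ∈ S) (hb : b ∈ S) : f a = f b :=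
  Complex.isCoveringMap_exp.constOn_of_comp hS hf
    (fun a ha b hb => Subtype.ext ((hw a ha).trans (hw b hb).symm)) ha hb

/-- In coordinates with the segment on the real axis, the quotient tends to the negative number `-(l
- s) / s`, from the upper half-plane on the left side and from the lower one on the right. The two
limits of the principal logarithm differ by `2πi`. -/
theorem tendsto_log_div_left {s l : ℝ} (hs : s ∈ Ioo 0 l) :
    Tendsto (fun ε : ℝ => Complex.log ((l - s - ε * Complex.I) / (-s - ε * Complex.I))) (𝓝[>] 0)
      (𝓝 (Real.log ((l - s) / s) + Real.pi * Complex.I)) := by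
  obtain ⟨hs0, hsl⟩ := hs
  have hsc : (s : ℂ) ≠ 0 := by exact_mod_cast hs0.ne'
  have hq : 0 < (l - s) / s := div_pos (sub_pos.2 hsl) hs0
  have h1 : Complex.log ((-((l - s) / s) : ℝ) : ℂ)
      = Real.log ((l - s) / s) + Real.pi * Complex.I := by
    rw [Complex.log, Complex.arg_ofReal_of_neg (neg_neg_of_pos hq), Complex.norm_real, norm_neg,
      Real.norm_of_nonneg hq.le]
  rw [← h1]
  refine (Complex.continuousWithinAt_log_of_re_neg_of_im_zero (by simpa using hq)
    (Complex.ofReal_im _)).tendsto.comp (tendsto_nhdsWithin_iff.2 ⟨?_, ?_⟩)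
  · have : ContinuousAt (fun ε : ℝ => ((l - s - ε * Complex.I) / (-s - ε * Complex.I) : ℂ)) 0 :=
      ContinuousAt.div (by fun_prop) (by fun_prop) (by simpa using hsc)
    convert this.tendsto.mono_left nhdsWithin_le_nhds using 2
    push_cast
    simp [div_neg]
  · filter_upwards [self_mem_nhdsWithin] with ε hε
    have hε' : 0 < ε := hε
    simp only [Complex.div_im, ← sub_div]
    refine div_nonneg ?_ (Complex.normSq_nonneg _)
    simp
    nlinarith

theorem tendsto_log_div_right {s l : ℝ} (hs : s ∈ Ioo 0 l) :
    Tendsto (fun ε : ℝ => Complex.log ((l - s + ε * Complex.I) / (-s + ε * Complex.I))) (𝓝[>] 0)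
      (𝓝 (Real.log ((l - s) / s) - Real.pi * Complex.I)) := by
  obtain ⟨hs0, hsl⟩ := hs
  have hsc : (s : ℂ) ≠ 0 := by exact_mod_cast hs0.ne'
  have hq : 0 < (l - s) / s := div_pos (sub_pos.2 hsl) hs0
  have h1 := Complex.tendsto_log_nhdsWithin_im_neg_of_re_neg_of_im_zero
    (z := ((-((l - s) / s) : ℝ) : ℂ)) (by simpa using hq) (Complex.ofReal_im _)
  rw [Complex.norm_real, norm_neg, Real.norm_of_nonneg hq.le] at h1
  refine h1.comp (tendsto_nhdsWithin_iff.2 ⟨?_, ?_⟩)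
  · have : ContinuousAt (fun ε : ℝ => ((l - s + ε * Complex.I) / (-s + ε * Complex.I) : ℂ)) 0 :=
      ContinuousAt.div (by fun_prop) (by fun_prop) (by simpa using hsc)
    convert this.tendsto.mono_left nhdsWithin_le_nhds using 2
    push_cast
    simp [div_neg]
  · filter_upwards [self_mem_nhdsWithin] with ε hε
    have hε' : 0 < ε := hε
    simp only [Complex.div_im, ← sub_div]
    refine div_neg_of_neg_of_pos ?_ (Complex.normSq_pos.2 fun h => ?_)
    · simp
      nlinarith
    · simpa [hs0.ne'] using congrArg Complex.re h

namespace FilmCurve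

variable (γ : FilmCurve)

theorem div_mem_slitPlane_of_not_mem_carrier (hk : γ.curvature = 0) {z : ℂ} (hz : z ∉ γ.carrier) :
    (γ.endPoint true - z) / (γ.endPoint false - z) ∈ Complex.slitPlane := by
  have hne : γ.endPoint false - z ≠ 0 :=
    sub_ne_zero.2 fun h => hz (h ▸ γ.endPoint_mem_carrier false)
  by_contra h
  rw [Complex.mem_slitPlane_iff, not_or, not_lt, not_not] at h
  obtain ⟨r, hr⟩ : ∃ r : ℝ, (r : ℂ) = (γ.endPoint true - z) / (γ.endPoint false - z) :=
    ⟨_, Complex.ext rfl (by rw [h.2, Complex.ofReal_im])⟩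
  rw [← hr, Complex.ofReal_re] at h
  have hr1 : 1 ≤ 1 - r := by linarith [h.1]
  -- Solving for `z` in the equation "quotient equals `r ≤ 0`" gives a point of the segment at this
  -- arc length.
  refine hz ⟨γ.length / (1 - r), ⟨div_nonneg γ.length_pos.le (by linarith),
    div_le_self γ.length_pos.le hr1⟩, ?_⟩
  have hrc : (1 - r : ℂ) ≠ 0 := by
    exact_mod_cast (show (1 - r : ℝ) ≠ 0 by linarith)
  rw [eq_div_iff hne] at hr
  simp only [endPoint, γ.point_of_curvature_eq_zero hk] at hr ⊢
  push_cast at hr ⊢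
  field_simp
  linear_combination -hr

theorem point_mem_relInterior (hk : γ.curvature = 0) {s : ℝ} (hs : s ∈ Ioo 0 γ.length) :
    γ.point s ∈ γ.relInterior := by
  have hd : γ.direction ≠ 0 := norm_ne_zero_iff.1 (by simp [γ.norm_direction])
  refine ⟨γ.point_mem_carrier ⟨hs.1.le, hs.2.le⟩, ?_⟩
  rintro ⟨-, _ | _, h⟩
  all_goals
    simp only [endPoint, γ.point_of_curvature_eq_zero hk, add_right_inj, mul_eq_mul_right_iff, hd,
      or_false, Complex.ofReal_inj] at h
  · exact hs.1.ne h
  · exact hs.2.ne' h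

end FilmCurve

/-- A walk around the segment gives a logarithm `f` continuous across it, while the principal
logarithm of the reciprocal quotient jumps by `2πi` there. Their sum `W` is a logarithm of `1`,
hence constant on the bubble, so it cannot have different limits on the two sides. -/
theorem PlateauLaws.isBridge_of_both_sides [Finite ι] (h : PlateauLaws c) {i : ι}
    (hk : (c i).curvature = 0) {B : Set ℂ} (hB : IsBubble c B) (hl : (c i).HasOnLeft B)
    (hr : (c i).HasOnRight B) : IsBridge (clusterGraph c) i := by
  have hfull : ¬ (c i).IsFullCircle := by
    simp [FilmCurve.IsFullCircle, hk, Real.pi_ne_zero]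
  refine ⟨(c i).endPoint true, (c i).endPoint false, ⟨hfull, true, rfl, rfl⟩, fun hwalk => ?_⟩
  obtain ⟨f, hf, hfe⟩ := exists_continuousOn_exp_of_reflTransGen hwalk
  set U : Set ℂ := {z | ∀ j, j ≠ i → z ∉ (c j).carrier} with hU
  have hUo : IsOpen U := by
    have : U = ⋂ j ∈ {j | j ≠ i}, (c j).carrierᶜ := by
      ext
      simp [hU]
    rw [this]
    exact (toFinite _).isOpen_biInter fun j _ => (c j).isCompact_carrier.isClosed.isOpen_compl
  have hpU : ∀ s ∈ Ioo 0 (c i).length, (c i).point s ∈ U := fun s hs j hj =>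
    disjoint_left.1 (h.disjoint i j hj.symm) ((c i).point_mem_relInterior hk hs)
  obtain ⟨z₀, hz₀, rfl⟩ := hB
  have hsub := connectedComponentIn_subset (film c)ᶜ z₀
  have hBU : ∀ z ∈ connectedComponentIn (film c)ᶜ z₀, z ∈ U ∧ z ∉ (c i).carrier := fun z hz =>
    ⟨fun j _ hj => hsub hz (mem_iUnion.2 ⟨j, hj⟩), fun hi => hsub hz (mem_iUnion.2 ⟨i, hi⟩)⟩
  set W : ℂ → ℂ := fun z =>
    f z + Complex.log (((c i).endPoint true - z) / ((c i).endPoint false - z)) with hW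
  have hne : ∀ b, ∀ z ∉ (c i).carrier, (c i).endPoint b - z ≠ 0 := fun b z hz =>
    sub_ne_zero.2 fun h => hz (h ▸ (c i).endPoint_mem_carrier b)
  have hWc : ContinuousOn W (connectedComponentIn (film c)ᶜ z₀) := by
    refine (hf.mono fun z hz => (hBU z hz).1).add (ContinuousOn.clog ?_ fun z hz =>
      (c i).div_mem_slitPlane_of_not_mem_carrier hk (hBU z hz).2)
    exact ContinuousOn.div (by fun_prop) (by fun_prop) fun z hz => hne false z (hBU z hz).2
  have hWe : ∀ z ∈ connectedComponentIn (film c)ᶜ z₀, Complex.exp (W z) = 1 := by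
    intro z hz
    obtain ⟨h1, h2⟩ := hBU z hz
    rw [hW, Complex.exp_add, Complex.exp_log (div_ne_zero (hne true z h2) (hne false z h2)),
      mul_div_assoc', mul_comm, hfe z h1, div_self (hne false z h2)]
  have hWconst : ∀ z ∈ connectedComponentIn (film c)ᶜ z₀, W z = W z₀ := fun z hz =>
    eq_of_exp_eq isPreconnected_connectedComponentIn hWc hWe hz (mem_connectedComponentIn hz₀)
  have hd : (c i).direction ≠ 0 := norm_ne_zero_iff.1 (by simp [(c i).norm_direction])
  have hT : ∀ s, (c i).tangent s = (c i).direction := by simp [FilmCurve.tangent, hk]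
  have hpoint := (c i).point_of_curvature_eq_zero hk
  -- The limits of `W` at the point of parameter `s` are `g s + πi` from the left and `g s - πi`
  -- from the right.
  set g : ℝ → ℂ := fun s => f ((c i).point s) + Real.log (((c i).length - s) / s) with hg
  have hleft : ∃ s ∈ Ioo 0 (c i).length, W z₀ = g s + Real.pi * Complex.I := by
    obtain ⟨s, hs, hε⟩ := hl
    refine ⟨s, hs, ?_⟩
    have h1 : Tendsto (fun ε : ℝ => (c i).point s + ε * (Complex.I * (c i).tangent s)) (𝓝[>] 0)
        (𝓝 ((c i).point s)) := by
      have : Continuous fun ε : ℝ => (c i).point s + ε * (Complex.I * (c i).tangent s) := by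
        fun_prop
      simpa using (this.tendsto 0).mono_left nhdsWithin_le_nhds
    have h2 := ((hf.continuousAt (hUo.mem_nhds (hpU s hs))).tendsto.comp h1).add
      (tendsto_log_div_left hs)
    rw [hg, add_assoc]
    refine tendsto_nhds_unique (tendsto_const_nhds.congr' ?_) h2
    filter_upwards [hε] with ε hz
    rw [← hWconst _ hz, hW]
    simp only [Function.comp_apply]
    congr 2
    rw [hT, ← mul_div_mul_right ((c i).length - s - ε * Complex.I) _ hd]
    simp only [FilmCurve.endPoint, hpoint]
    congr 1 <;> push_cast <;> ring
  have hright : ∃ s ∈ Ioo 0 (c i).length, W z₀ = g s - Real.pi * Complex.I := by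
    obtain ⟨s, hs, hε⟩ := hr
    refine ⟨s, hs, ?_⟩
    have h1 : Tendsto (fun ε : ℝ => (c i).point s - ε * (Complex.I * (c i).tangent s)) (𝓝[>] 0)
        (𝓝 ((c i).point s)) := by
      have : Continuous fun ε : ℝ => (c i).point s - ε * (Complex.I * (c i).tangent s) := by
        fun_prop
      simpa using (this.tendsto 0).mono_left nhdsWithin_le_nhds
    have h2 := ((hf.continuousAt (hUo.mem_nhds (hpU s hs))).tendsto.comp h1).add
      (tendsto_log_div_right hs)
    rw [hg, add_sub_assoc]
    refine tendsto_nhds_unique (tendsto_const_nhds.congr' ?_) h2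
    filter_upwards [hε] with ε hz
    rw [← hWconst _ hz, hW]
    simp only [Function.comp_apply]
    congr 2
    rw [hT, ← mul_div_mul_right ((c i).length - s + ε * Complex.I) _ hd]
    simp only [FilmCurve.endPoint, hpoint]
    congr 1 <;> push_cast <;> ring
  have hgc : ContinuousOn g (Ioo 0 (c i).length) := by
    refine (hf.comp (c i).continuous_point.continuousOn hpU).add
      (Complex.continuous_ofReal.comp_continuousOn (ContinuousOn.log ?_ fun s hs => ?_))
    · exact ContinuousOn.div (by fun_prop) (by fun_prop) fun s hs => hs.1.ne'
    · exact (div_pos (sub_pos.2 hs.2) hs.1).ne'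
  -- The bubble may touch the two sides at different parameters; they can be compared because `g`, a
  -- continuous logarithm of `-1`, is constant.
  have hge : ∀ s ∈ Ioo 0 (c i).length, Complex.exp (g s) = -1 := by
    intro s hs
    have h1 := hfe _ (hpU s hs)
    have h2 : (s : ℂ) ≠ 0 := by exact_mod_cast hs.1.ne'
    rw [hg, Complex.exp_add, ← Complex.ofReal_exp, Real.exp_log (div_pos (sub_pos.2 hs.2) hs.1)]
    simp only [FilmCurve.endPoint, hpoint] at h1 ⊢
    push_cast at h1 ⊢
    field_simp
    apply mul_left_cancel₀ hd
    linear_combination h1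
  obtain ⟨s, hs, hs'⟩ := hleft
  obtain ⟨t, ht, ht'⟩ := hright
  rw [eq_of_exp_eq isPreconnected_Ioo hgc hge hs ht] at hs'
  have hpi : (Real.pi : ℂ) * Complex.I = 0 := by linear_combination (ht' - hs') / 2
  simp [Real.pi_ne_zero] at hpi

end SoapBubble

end

theorem mainTheorem5 {ι : Type*} [Finite ι] (c : ι → SoapBubble.FilmCurve)
    (hc : SoapBubble.IsPlanarCluster c) :
    (∀ i B, SoapBubble.IsBubble c B → ¬ ((c i).HasOnLeft B ∧ (c i).HasOnRight B)) ∧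
      SoapBubble.Bridgeless (SoapBubble.clusterGraph c) := by
  refine ⟨fun i B hB ⟨hl, hr⟩ => hc.bridgeless i ?_, hc.bridgeless⟩
  obtain ⟨σ, hσ, pressure, hYL⟩ := hc.youngLaplace
  have hk := hYL i B B hB hB hl hr
  rw [sub_self, eq_comm, mul_eq_zero] at hk
  exact hc.plateau.isBridge_of_both_sides (hk.resolve_left hσ.ne') hB hl hr
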